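/- A $(+,\circ)$-structure is a non-empty set equipped with two binary operations $+$ and $\circ$. For binary relations $R,S\subseteq X\times X$ on a set $X$ let $\mathrm{d}(R)=\{x\in X:\exists y\,(x,y)\in R\}$, let $$R\sqcup S=\{(x,y)\in R\cup S: x\in \mathrm{d}(R)\cap \mathrm{d}(S)\}$$ be their demonic join, and let $$R;S=\{(x,z)\in X\times X:\exists y\,((x,y)\in R\wedge (y,z)\in S)\}$$ be their ordinary composition. A $(+,\circ)$-structure is $(\sqcup,;)$-representable if it is isomorphic to a structure whose elements are binary relations on some set $X$, forming a set closed under $\sqcup$ and $;$, where $+$ is interpreted as $\sqcup$ and $\circ$ as $;$. Let $R(\sqcup,;)$ be the class of all $(\sqcup,;)$-representable structures. **Theorem.** $R(\sqcup,;)$ is not finitely axiomatisable: there is no finite set $\Psi$ of first-order sentences in the signature $(+,\circ)$ such that, for every $(+,\circ)$-structure $\mathcal S$, $\mathcal S\models\Psi$ if and only if $\mathcal S\in R(\sqcup,;)$. -/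

import Mathlib

open FirstOrder

universe u

namespace DemonicJoin

/-- The two binary function symbols: abstract join `+` and abstract composition `∘`. -/
inductive Op : ℕ → Type
  | add : Op 2
  | comp : Op 2

/-- The first-order language of `(+, ∘)`-structures: two binary function symbols
and no relation symbols (equality is logical). -/
def Lang : FirstOrder.Language.{0, 0} := ⟨Op, fun _ => Empty⟩

/-- Binary relations over the base `X`, as sets of pairs. -/
abbrev BinRel (X : Type*) := Set (X × X)

namespace BinRel

variable {X : Type*}

/-- The domain `d(R)` of a relation. -/
def dom (R : BinRel X) : Set X := {x | ∃ y, (x, y) ∈ R}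

/-- Restriction of a relation to the pairs whose first coordinate lies in `A`. -/
def restrict (R : BinRel X) (A : Set X) : BinRel X := {q | q ∈ R ∧ q.1 ∈ A}

/-- Demonic join: `R ⊔ S` is `R ∪ S` restricted to `d(R) ∩ d(S)`. -/
def demonicJoin (R S : BinRel X) : BinRel X := restrict (R ∪ S) (dom R ∩ dom S)

/-- Ordinary (angelic) composition `R ; S`. -/
def comp (R S : BinRel X) : BinRel X := {q | ∃ y, (q.1, y) ∈ R ∧ (y, q.2) ∈ S}

/-- The algebra of all binary relations over `X`: `+` is demonic join, `∘` is ordinary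
composition. -/
instance fullStructure : Lang.Structure (BinRel X) where
  funMap {_} f :=
    match f with
    | Op.add => fun v => demonicJoin (v 0) (v 1)
    | Op.comp => fun v => comp (v 0) (v 1)
  RelMap {_} r := r.elim

end BinRel

/-- A `(+, ∘)`-structure is representable if it is isomorphic to a proper structure, that is, to a
set of binary relations over some base `X` closed under demonic join and ordinary composition,
with these as its operations. -/
def Representable (S : Type u) [Lang.Structure S] : Prop :=
  ∃ (X : Type u) (P : Lang.Substructure (BinRel X)), Nonempty (S ≃[Lang] P)

end DemonicJoin

/-! No `Elt n` with n > 0 is representable, yet a nonprincipal ultraproduct of them is. By Łoś, a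
finite axiomatisation true in the ultraproduct would be true in almost all factors, a contradiction.

In a representation of `Elt n`, `bot` forces all domains to agree, so join is union. Since 0 ∘ 0 ≠
`bot`, some path p, r, q has both edges in 0 and (p, q) outside `bot`. The covers 0 ≤ (2k+1) +
(2k+2) and the orthogonalities 2k ⟂ 2k+1 push both edges from 2k to 2k+2, up to 2n, and 2n ⟂ 0 is
violated (`Elt.not_representable`).

The obstruction needs a chain of length n. If |F| + 1 < n, some {2t+1} with 1 ≤ t < n is not the set
of any member of F. Cutting the chain there gives a representation respecting the operations at
arguments from F (`Elt.exists_compatible`, `Elt.exists_partial_representation`), and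
`representable_product` glues these. -/

open FirstOrder.Language Filter

namespace DemonicJoin

/-! ### Representations as injective maps -/

section Representations

variable {S : Type u} [Lang.Structure S]

/-- The join operation of a `(+, ∘)`-structure. -/
def join (a b : S) : S := Structure.funMap (L := Lang) Op.add ![a, b]

/-- The composition operation of a `(+, ∘)`-structure. -/
def mul (a b : S) : S := Structure.funMap (L := Lang) Op.comp ![a, b]

theorem funMap_add (v : Fin 2 → S) : Structure.funMap (L := Lang) Op.add v = join (v 0) (v 1) := by
  unfold join
  congr 1
  funext i
  fin_cases i <;> rfl

theorem funMap_comp (v : Fin 2 → S) : Structure.funMap (L := Lang) Op.comp v = mul (v 0) (v 1) := by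
  unfold mul
  congr 1
  funext i
  fin_cases i <;> rfl

theorem representable_of_injective {X : Type u} (θ : S → BinRel X) (hθ : Function.Injective θ)
    (hjoin : ∀ a b, θ (join a b) = BinRel.demonicJoin (θ a) (θ b))
    (hmul : ∀ a b, θ (mul a b) = BinRel.comp (θ a) (θ b)) : Representable S := by
  let f : S ↪[Lang] BinRel X :=
    { toFun := θ
      inj' := hθ
      map_fun' := by
        intro n f v
        cases f with
        | add => exact (congrArg θ (funMap_add v)).trans (hjoin _ _)
        | comp => exact (congrArg θ (funMap_comp v)).trans (hmul _ _)
      map_rel' := fun r _ => r.elim }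
  exact ⟨X, f.toHom.range, ⟨f.equivRange⟩⟩

theorem Representable.exists_injective (h : Representable S) :
    ∃ (X : Type u) (θ : S → BinRel X), Function.Injective θ ∧
      (∀ a b, θ (join a b) = BinRel.demonicJoin (θ a) (θ b)) ∧
      ∀ a b, θ (mul a b) = BinRel.comp (θ a) (θ b) := by
  obtain ⟨X, P, ⟨e⟩⟩ := h
  let f : S ↪[Lang] BinRel X := P.subtype.comp e.toEmbedding
  exact ⟨X, f, f.injective, fun a b => f.map_fun Op.add ![a, b],
    fun a b => f.map_fun Op.comp ![a, b]⟩

/-- A structure is representable as soon as each of its finite subsets is represented, with the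
operations respected at arguments from that subset. -/
theorem representable_of_finite
    (H : ∀ F : Finset S, ∃ (X : Type u) (_ : Nonempty X) (θ : S → BinRel X),
      ∀ a ∈ F, ∀ b ∈ F, (θ a = θ b → a = b) ∧
        θ (join a b) = BinRel.demonicJoin (θ a) (θ b) ∧ θ (mul a b) = BinRel.comp (θ a) (θ b)) :
    Representable S := by
  classical
  choose X hX θ hθ using H
  let U : Ultrafilter (Finset S) := Ultrafilter.of atTop
  have hU : ∀ a b : S, ∀ᶠ F in (U : Filter (Finset S)), a ∈ F ∧ b ∈ F := fun a b =>
    Ultrafilter.of_le _ <| (eventually_ge_atTop {a, b}).mono fun F hF =>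
      ⟨hF (by simp), hF (by simp)⟩
  -- The ultraproduct of the partial representations. As `U` refines `atTop`, any two given elements
  -- lie in almost every `F`, so conditions at arguments from `F` suffice.
  let Θ : S → BinRel (∀ F, X F) := fun a => {q | ∀ᶠ F in U, (q.1 F, q.2 F) ∈ θ F a}
  have hex : ∀ Q : ∀ F, X F → Prop,
      (∀ᶠ F in (U : Filter (Finset S)), ∃ y, Q F y) ↔ ∃ y : ∀ F, X F, ∀ᶠ F in U, Q F (y F) := by
    intro Q
    constructor
    · intro h
      -- The arbitrary value, available because every base is nonempty, occurs only on a null set of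
      -- indices.
      refine ⟨fun F => if h : ∃ y, Q F y then h.choose else Classical.arbitrary _, ?_⟩
      filter_upwards [h] with F hF
      rw [dif_pos hF]
      exact hF.choose_spec
    · rintro ⟨y, hy⟩
      exact hy.mono fun F hF => ⟨_, hF⟩
  have hdom : ∀ a x, x ∈ BinRel.dom (Θ a) ↔ ∀ᶠ F in U, x F ∈ BinRel.dom (θ F a) :=
    fun a x => (hex fun F y => (x F, y) ∈ θ F a).symm
  refine representable_of_injective Θ ?_ ?_ ?_
  · intro a b hab
    by_contra hne
    have h1 : ∀ᶠ F in (U : Filter (Finset S)), ∃ q : X F × X F, ¬ (q ∈ θ F a ↔ q ∈ θ F b) := by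
      filter_upwards [hU a b] with F hF
      by_contra! h
      exact hne ((hθ F a hF.1 b hF.2).1 (Set.ext h))
    have h2 : ∀ᶠ F in (U : Filter (Finset S)), ∃ x, ∃ y, ¬ ((x, y) ∈ θ F a ↔ (x, y) ∈ θ F b) :=
      h1.mono fun F ⟨q, hq⟩ => ⟨q.1, q.2, hq⟩
    obtain ⟨x, hx⟩ := (hex _).1 h2
    obtain ⟨y, hy⟩ := (hex _).1 hx
    have h3 : (x, y) ∈ Θ a ↔ (x, y) ∈ Θ b := by rw [hab]
    by_cases ha : (x, y) ∈ Θ a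
    · obtain ⟨F, hF, hFa, hFb⟩ := (hy.and (Eventually.and ha (h3.1 ha))).exists
      exact hF (iff_of_true hFa hFb)
    · have hb : ¬ (x, y) ∈ Θ b := fun h => ha (h3.2 h)
      obtain ⟨F, hF, hFa, hFb⟩ := (hy.and (Eventually.and
        (Ultrafilter.eventually_not.2 ha) (Ultrafilter.eventually_not.2 hb))).exists
      exact hF (iff_of_false hFa hFb)
  · intro a b
    ext ⟨x, y⟩
    have h1 : (x, y) ∈ Θ (join a b) ↔ ∀ᶠ F in U, (((x F, y F) ∈ θ F a ∨ (x F, y F) ∈ θ F b) ∧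
        x F ∈ BinRel.dom (θ F a) ∧ x F ∈ BinRel.dom (θ F b)) := by
      refine eventually_congr ?_
      filter_upwards [hU a b] with F hF
      rw [(hθ F a hF.1 b hF.2).2.1]
      rfl
    rw [h1, eventually_and, eventually_and, Ultrafilter.eventually_or, ← hdom, ← hdom]
    rfl
  · intro a b
    ext ⟨x, z⟩
    have h1 : (x, z) ∈ Θ (mul a b) ↔
        ∀ᶠ F in U, ∃ y, (x F, y) ∈ θ F a ∧ (y, z F) ∈ θ F b := by
      refine eventually_congr ?_
      filter_upwards [hU a b] with F hF
      rw [(hθ F a hF.1 b hF.2).2.2]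
      rfl
    rw [h1, hex]
    simp only [eventually_and]
    rfl

/-- An ultraproduct of structures is representable if, for every `k`, almost all factors have
partial representations on all their subsets with at most `k` elements. -/
theorem representable_product {S : ℕ → Type u} [∀ n, Lang.Structure (S n)] [∀ n, Nonempty (S n)]
    (U : Ultrafilter ℕ)
    (H : ∀ k, ∀ᶠ n in (U : Filter ℕ), ∀ F : Finset (S n), F.card ≤ k →
      ∃ (X : Type u) (_ : Nonempty X) (θ : S n → BinRel X),
      ∀ a ∈ F, ∀ b ∈ F, (θ a = θ b → a = b) ∧
        θ (join a b) = BinRel.demonicJoin (θ a) (θ b) ∧ θ (mul a b) = BinRel.comp (θ a) (θ b)) :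
    Representable ((U : Filter ℕ).Product S) := by
  classical
  refine representable_of_finite fun F => ?_
  let r : (U : Filter ℕ).Product S → ∀ n, S n := Quotient.out
  have hr : ∀ a, Quotient.mk _ (r a) = a := Quotient.out_eq
  have hjoin : ∀ a b, ∀ᶠ n in (U : Filter ℕ), r (join a b) n = join (r a n) (r b n) := by
    intro a b
    have h : join a b = Quotient.mk _ (fun n => join (r a n) (r b n)) := by
      conv_lhs => rw [← hr a, ← hr b]
      have := Ultraproduct.funMap_cast (L := Lang) (M := S) (u := U) Op.add ![r a, r b]
      rw [funMap_add] at this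
      refine this.trans (congrArg _ (funext fun n => funMap_add _))
    exact Quotient.exact ((hr _).trans h)
  have hmul : ∀ a b, ∀ᶠ n in (U : Filter ℕ), r (mul a b) n = mul (r a n) (r b n) := by
    intro a b
    have h : mul a b = Quotient.mk _ (fun n => mul (r a n) (r b n)) := by
      conv_lhs => rw [← hr a, ← hr b]
      have := Ultraproduct.funMap_cast (L := Lang) (M := S) (u := U) Op.comp ![r a, r b]
      rw [funMap_comp] at this
      refine this.trans (congrArg _ (funext fun n => funMap_comp _))
    exact Quotient.exact ((hr _).trans h)
  have hne : ∀ a b, ∀ᶠ n in (U : Filter ℕ), r a n = r b n → a = b := by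
    intro a b
    by_cases hab : a = b
    · exact Eventually.of_forall fun _ _ => hab
    · have h : ¬ ∀ᶠ n in (U : Filter ℕ), r a n = r b n := fun h =>
        hab ((hr a).symm.trans ((Quotient.sound h).trans (hr b)))
      exact (Ultrafilter.eventually_not.2 h).mono fun n hn h => absurd h hn
  have hF : ∀ᶠ n in (U : Filter ℕ), ∀ a ∈ F, ∀ b ∈ F, (r a n = r b n → a = b) ∧
      r (join a b) n = join (r a n) (r b n) ∧ r (mul a b) n = mul (r a n) (r b n) := by
    simp only [Finset.eventually_all]
    exact fun a _ b _ => (hne a b).and ((hjoin a b).and (hmul a b))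
  -- Only arguments must lie in the small set, so k = |F| suffices even though joins and products
  -- may leave it.
  obtain ⟨n, hn, hn'⟩ := (hF.and (H F.card)).exists
  obtain ⟨X, hX, θ, hθ⟩ := hn' (F.image fun a => r a n) Finset.card_image_le
  refine ⟨X, hX, fun a => θ (r a n), fun a ha b hb => ?_⟩
  obtain ⟨h1, h2, h3⟩ := hn a ha b hb
  obtain ⟨k1, k2, k3⟩ := hθ _ (Finset.mem_image_of_mem _ ha) _ (Finset.mem_image_of_mem _ hb)
  exact ⟨fun h => h1 (k1 h), by simp only [h2, k2], by simp only [h3, k3]⟩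

end Representations


/-! ### The structures `Elt n` -/

/-- Orthogonality on `ℕ`: the pairs `{2k, 2k+1}` for `k < n`, and the pair `{2n, 0}`. -/
def Orth (n i j : ℕ) : Prop :=
  (∃ k < n, i = 2 * k ∧ j = 2 * k + 1 ∨ i = 2 * k + 1 ∧ j = 2 * k) ∨
    i = 2 * n ∧ j = 0 ∨ i = 0 ∧ j = 2 * n

theorem Orth.symm {n i j : ℕ} (h : Orth n i j) : Orth n j i := by
  rcases h with ⟨k, hk, h | h⟩ | h | h
  · exact Or.inl ⟨k, hk, Or.inr h.symm⟩
  · exact Or.inl ⟨k, hk, Or.inl h.symm⟩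
  · exact Or.inr (Or.inr h.symm)
  · exact Or.inr (Or.inl h.symm)

/-- A set of naturals is closed if it contains `0` as soon as it contains some pair
`{2k+1, 2k+2}`. -/
def IsClosedSet (A : Set ℕ) : Prop := ∀ k, 2 * k + 1 ∈ A → 2 * k + 2 ∈ A → 0 ∈ A

/-- The closure of a set of naturals. -/
def closure (A : Set ℕ) : Set ℕ := {i | i ∈ A ∨ i = 0 ∧ ∃ k, 2 * k + 1 ∈ A ∧ 2 * k + 2 ∈ A}

/-- One step suffices: the only point added is 0, which is never of the form 2k+1 or 2k+2. -/
theorem isClosedSet_closure (A : Set ℕ) : IsClosedSet (closure A) := by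
  rintro k (h1 | h1) (h2 | h2)
  · exact Or.inr ⟨rfl, k, h1, h2⟩
  all_goals omega

theorem closure_subset_iff {A K : Set ℕ} (hK : IsClosedSet K) : closure A ⊆ K ↔ A ⊆ K := by
  refine ⟨fun h i hi => h (Or.inl hi), fun h => ?_⟩
  rintro i (hi | ⟨rfl, k, h1, h2⟩)
  · exact h hi
  · exact hK k (h h1) (h h2)

theorem isClosedSet_of_zero_mem {A : Set ℕ} (h : 0 ∈ A) : IsClosedSet A := fun _ _ _ => h

theorem isClosedSet_singleton (i : ℕ) : IsClosedSet {i} := by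
  intro k h1 h2
  simp only [Set.mem_singleton_iff] at h1 h2
  omega

/-- Two sets pair nontrivially if they have non-orthogonal members. -/
def Pairing (n : ℕ) (A B : Set ℕ) : Prop := ∃ i ∈ A, ∃ j ∈ B, ¬ Orth n i j

/-- The elements of the `n`-th structure: a closed set of naturals together with a truth value. -/
@[ext]
structure Elt (n : ℕ) : Type u where
  /-- The underlying set. -/
  set : Set ℕ
  /-- The truth value. -/
  flag : Prop
  isClosedSet : IsClosedSet set

namespace Elt

variable {n : ℕ}

instance : Lang.Structure (Elt.{u} n) where
  funMap {_} f :=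
    match f with
    | Op.add => fun v => ⟨closure ((v 0).set ∪ (v 1).set), (v 0).flag ∨ (v 1).flag,
        isClosedSet_closure _⟩
    | Op.comp => fun v => ⟨∅, Pairing n (v 0).set (v 1).set, fun _ h => h.elim⟩
  RelMap {_} r := r.elim

theorem join_set (a b : Elt.{u} n) : (join a b).set = closure (a.set ∪ b.set) := rfl

theorem join_flag (a b : Elt.{u} n) : (join a b).flag = (a.flag ∨ b.flag) := rfl

theorem mul_flag (a b : Elt.{u} n) : (mul a b).flag = Pairing n a.set b.set := rfl

/-- The least element. -/
def bot : Elt.{u} n := ⟨∅, False, fun _ h => h.elim⟩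

/-- The atom given by a natural number. -/
def single (i : ℕ) : Elt.{u} n := ⟨{i}, False, isClosedSet_singleton i⟩

instance : Nonempty (Elt.{u} n) := ⟨bot⟩

/-! ### Equations of `Elt n` and non-representability -/

theorem join_bot (a : Elt.{u} n) : join a bot = a := by
  ext i
  · rw [join_set]
    refine ⟨?_, fun h => Or.inl (Or.inl h)⟩
    rintro (h | ⟨rfl, k, h1, h2⟩)
    · exact h.resolve_right fun h => h
    · exact a.isClosedSet k (h1.resolve_right fun h => h) (h2.resolve_right fun h => h)
  · simp [join_flag, bot]

theorem mul_bot (a : Elt.{u} n) : mul a bot = bot := by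
  ext
  · rfl
  · simp [mul_flag, bot, Pairing]

theorem mul_single_of_orth {i j : ℕ} (h : Orth n i j) :
    mul (single i : Elt.{u} n) (single j) = bot := by
  ext
  · rfl
  · simp [mul_flag, bot, single, Pairing, h]

theorem join_single_zero (k : ℕ) :
    join (single 0 : Elt.{u} n) (join (single (2 * k + 1)) (single (2 * k + 2))) =
      join (single (2 * k + 1)) (single (2 * k + 2)) := by
  ext i
  · refine ⟨?_, fun h => Or.inl (Or.inr h)⟩
    rw [join_set, join_set]
    have h0 : 0 ∈ closure ((single (2 * k + 1) : Elt.{u} n).set ∪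
        (single (2 * k + 2) : Elt.{u} n).set) := Or.inr ⟨rfl, k, Or.inl rfl, Or.inr rfl⟩
    rintro (h | h)
    · refine h.elim (fun h => ?_) id
      obtain rfl : i = 0 := h
      exact h0
    · obtain rfl := h.1
      exact h0
  · simp [join_flag, single]

/-- For n = 0 the closing pair {2n, 0} would make 0 orthogonal to itself. -/
theorem not_orth_zero_zero (hn : 0 < n) : ¬ Orth n 0 0 := by
  rintro (⟨k, hk, h⟩ | h) <;> omega

theorem mul_single_zero_ne (hn : 0 < n) : mul (single 0 : Elt.{u} n) (single 0) ≠ bot := by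
  intro h
  have : Pairing n {0} {0} = False := congrArg Elt.flag h
  exact this.mp ⟨0, rfl, 0, rfl, not_orth_zero_zero hn⟩

theorem not_representable (hn : 0 < n) : ¬ Representable (Elt.{u} n) := by
  intro h
  obtain ⟨X, θ, hinj, hjoin, hmul⟩ := h.exists_injective
  -- a + `bot` = a gives one inclusion, a ∘ `bot` = `bot` the other.
  have hdom : ∀ a, BinRel.dom (θ a) = BinRel.dom (θ bot) := by
    intro a
    ext x
    constructor
    · rintro ⟨y, hy⟩
      rw [← join_bot a, hjoin] at hy
      exact hy.2.2
    · rintro ⟨y, hy⟩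
      rw [← mul_bot a, hmul] at hy
      exact hy.imp fun _ h => h.1
  have hun : ∀ a b, θ (join a b) = θ a ∪ θ b := by
    intro a b
    rw [hjoin]
    refine Set.ext fun q => ⟨fun h => h.1, fun h => ⟨h, ?_⟩⟩
    rw [hdom a, hdom b, Set.inter_self]
    rcases h with h | h
    · rw [← hdom a]; exact ⟨q.2, h⟩
    · rw [← hdom b]; exact ⟨q.2, h⟩
  -- Since `bot` lies below everything, 0 ∘ 0 ⊆ `bot` would give equality.
  obtain ⟨⟨p, q⟩, hpq, hpq0⟩ : ∃ x ∈ θ (mul (single 0) (single 0)), x ∉ θ bot := by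
    by_contra! hle
    refine mul_single_zero_ne (n := n) hn (hinj (subset_antisymm hle ?_))
    rw [← join_bot (mul _ _), hun]
    exact Set.subset_union_right
  rw [hmul] at hpq
  obtain ⟨r, hpr, hrq⟩ := hpq
  have horth : ∀ i j, Orth n i j → (p, r) ∈ θ (single i) → (r, q) ∉ θ (single j) := by
    intro i j hij h1 h2
    refine hpq0 ?_
    rw [← mul_single_of_orth hij, hmul]
    exact ⟨r, h1, h2⟩
  have hcover : ∀ k x, x ∈ θ (single 0) → x ∉ θ (single (2 * k + 1)) →
      x ∈ θ (single (2 * k + 2)) := by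
    intro k x h0 h1
    have h : x ∈ θ (join (single (2 * k + 1)) (single (2 * k + 2))) := by
      rw [← join_single_zero, hun]
      exact Or.inl h0
    rw [hun] at h
    exact h.resolve_left h1
  -- One edge in 2k keeps the other out of 2k+1, and the cover of 0 then puts that edge in 2k+2.
  have key : ∀ k ≤ n, (p, r) ∈ θ (single (2 * k)) ∧ (r, q) ∈ θ (single (2 * k)) := by
    intro k
    induction k with
    | zero => exact fun _ => ⟨hpr, hrq⟩
    | succ k ih =>
      intro hk
      obtain ⟨h1, h2⟩ := ih (by omega)
      exact ⟨hcover k _ hpr fun h =>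
          horth _ _ (Or.inl ⟨k, by omega, Or.inr ⟨rfl, rfl⟩⟩) h h2,
        hcover k _ hrq fun h =>
          horth _ _ (Or.inl ⟨k, by omega, Or.inl ⟨rfl, rfl⟩⟩) h1 h⟩
  exact horth _ _ (Or.inr (Or.inl ⟨rfl, rfl⟩)) (key n le_rfl).1 hrq

/-! ### Partial representations on small subsets -/

/-- A pair of closed sets is compatible with a family of elements if members of the family that
are not contained in the first, respectively the second, set of the pair do pair nontrivially. -/
def Compatible (F : Set (Elt.{u} n)) (K L : Set ℕ) : Prop :=
  IsClosedSet K ∧ IsClosedSet L ∧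
    ∀ a ∈ F, ∀ b ∈ F, ¬ a.set ⊆ K → ¬ b.set ⊆ L → Pairing n a.set b.set

/-- The base of the partial representation: a source, a target, a sink, and one midpoint for each
compatible pair. -/
inductive Point (F : Set (Elt.{u} n)) : Type u
  | src
  | tgt
  | sink
  | mid (K L : Set ℕ) (h : Compatible F K L)

/-- The edges of the partial representation. -/
inductive Edge (F : Set (Elt.{u} n)) (a : Elt.{u} n) : Point F → Point F → Prop
  | sink (x) : Edge F a x .sink
  | flag : a.flag → Edge F a .src .tgt
  | left (K L h) : ¬ a.set ⊆ K → Edge F a .src (.mid K L h)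
  | right (K L h) : ¬ a.set ⊆ L → Edge F a (.mid K L h) .tgt

/-- The relation representing an element. -/
def rel (F : Set (Elt.{u} n)) (a : Elt.{u} n) : BinRel (Point F) := {x | Edge F a x.1 x.2}

/-- Nothing escapes the full set, so (K, `Set.univ`) is compatible for every closed K; these
midpoints recover the set, and the edge from source to target recovers the flag. -/
theorem rel_injective (F : Set (Elt.{u} n)) : Function.Injective (rel F) := by
  intro a b hab
  have hE : ∀ x y, Edge F a x y ↔ Edge F b x y := fun x y => Set.ext_iff.1 hab (x, y)
  have hsub : ∀ K, IsClosedSet K → (a.set ⊆ K ↔ b.set ⊆ K) := by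
    intro K hK
    have hc : Compatible F K Set.univ :=
      ⟨hK, fun _ _ _ => trivial, fun _ _ b _ _ h => absurd (Set.subset_univ _) h⟩
    have h1 : ∀ c : Elt.{u} n, Edge F c .src (.mid K Set.univ hc) ↔ ¬ c.set ⊆ K :=
      fun c => ⟨fun | .left _ _ _ h => h, fun h => .left _ _ _ h⟩
    exact not_iff_not.1 ((h1 a).symm.trans ((hE _ _).trans (h1 b)))
  ext1
  · exact subset_antisymm ((hsub _ b.isClosedSet).2 subset_rfl)
      ((hsub _ a.isClosedSet).1 subset_rfl)
  · have h1 : ∀ c : Elt.{u} n, Edge F c .src .tgt ↔ c.flag :=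
      fun c => ⟨fun | .flag h => h, fun h => .flag h⟩
    exact propext ((h1 a).symm.trans ((hE _ _).trans (h1 b)))

theorem mem_dom_rel (F : Set (Elt.{u} n)) (a : Elt.{u} n) (x : Point F) :
    x ∈ BinRel.dom (rel F a) := ⟨.sink, .sink x⟩

/-- The sink makes every relation total, so demonic join is union; for closed K, a join escapes K
exactly when one of its arguments does. -/
theorem rel_join (F : Set (Elt.{u} n)) (a b : Elt.{u} n) :
    rel F (join a b) = BinRel.demonicJoin (rel F a) (rel F b) := by
  have hsub : ∀ K, IsClosedSet K → (¬ (join a b).set ⊆ K ↔ ¬ a.set ⊆ K ∨ ¬ b.set ⊆ K) := by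
    intro K hK
    rw [join_set, closure_subset_iff hK, Set.union_subset_iff, not_and_or]
  ext ⟨x, y⟩
  constructor
  · intro h
    refine ⟨?_, mem_dom_rel F a x, mem_dom_rel F b x⟩
    cases h with
    | sink => exact Or.inl (.sink x)
    | flag h => exact h.imp .flag .flag
    | left K L hc h => exact ((hsub K hc.1).1 h).imp (.left K L hc) (.left K L hc)
    | right K L hc h => exact ((hsub L hc.2.1).1 h).imp (.right K L hc) (.right K L hc)
  · rintro ⟨h | h, -⟩
    · cases h with
      | sink => exact .sink x
      | flag h => exact .flag (Or.inl h)
      | left K L hc h => exact .left K L hc ((hsub K hc.1).2 (Or.inl h))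
      | right K L hc h => exact .right K L hc ((hsub L hc.2.1).2 (Or.inl h))
    · cases h with
      | sink => exact .sink x
      | flag h => exact .flag (Or.inr h)
      | left K L hc h => exact .left K L hc ((hsub K hc.1).2 (Or.inr h))
      | right K L hc h => exact .right K L hc ((hsub L hc.2.1).2 (Or.inr h))

/-- Every path of two edges ends in the sink, except source–midpoint–target. Compatibility makes
such a path imply pairing; `hF` supplies the converse. -/
theorem rel_mul {F : Set (Elt.{u} n)} {a b : Elt.{u} n} (ha : a ∈ F) (hb : b ∈ F)
    (hF : Pairing n a.set b.set → ∃ K L, Compatible F K L ∧ ¬ a.set ⊆ K ∧ ¬ b.set ⊆ L) :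
    rel F (mul a b) = BinRel.comp (rel F a) (rel F b) := by
  ext ⟨x, z⟩
  constructor
  · intro h
    cases h with
    | sink => exact ⟨.sink, .sink x, .sink _⟩
    | flag h =>
      obtain ⟨K, L, hc, h1, h2⟩ := hF h
      exact ⟨.mid K L hc, .left K L hc h1, .right K L hc h2⟩
    | left K L hc h => exact absurd (Set.empty_subset K) h
    | right K L hc h => exact absurd (Set.empty_subset L) h
  · rintro ⟨y, h1, h2⟩
    cases h1 with
    | sink => cases h2; exact .sink x
    | flag h => cases h2; exact .sink _
    | left K L hc h =>
      cases h2 with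
      | sink => exact .sink _
      | right _ _ _ h' => exact .flag (hc.2.2 a ha b hb h h')
    | right K L hc h => cases h2; exact .sink _

/-- No j is orthogonal to both 2k+1 and 2k+2. This fails for n = 1, where 0 is orthogonal to 1 and
2. -/
theorem isClosedSet_orth (hn : 1 < n) (j : ℕ) : IsClosedSet {i | Orth n i j} := by
  rintro k (⟨k, hk, h⟩ | h) (⟨l, hl, h'⟩ | h') <;> omega

theorem exists_compatible (hn : 1 < n) (F : Set (Elt.{u} n)) {t : ℕ} (ht : 0 < t) (htn : t < n)
    (hF : ∀ a ∈ F, a.set ≠ {2 * t + 1}) {A B : Set ℕ} (h : Pairing n A B) :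
    ∃ K L, Compatible F K L ∧ ¬ A ⊆ K ∧ ¬ B ⊆ L := by
  obtain ⟨i, hi, j, hj, hij⟩ := h
  -- The complement of a nonzero point contains 0, hence is closed, and pairs with the set
  -- orthogonal to that point. Only i = j = 0 needs the cut at t.
  by_cases hj0 : j = 0
  · by_cases hi0 : i = 0
    · subst hi0 hj0
      -- K takes one point of each pair {2k+1, 2k+2}, switching from odd to even at t; it is closed
      -- without containing 0, and {2t, 2t+1} is the only orthogonal pair outside it.
      let K : Set ℕ := {i | ∃ k, k < t ∧ i = 2 * k + 1 ∨ t ≤ k ∧ i = 2 * k + 2}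
      have h0 : 0 ∉ K := by rintro ⟨k, hk⟩; omega
      have hK : IsClosedSet K := by
        rintro k ⟨l, hl⟩ ⟨m, hm⟩; omega
      have hodd : ∀ k, k < t → 2 * k + 1 ∈ K := fun k hk => ⟨k, Or.inl ⟨hk, rfl⟩⟩
      have heven : ∀ k, t < k → 2 * k ∈ K := fun k hk => ⟨k - 1, Or.inr ⟨by omega, by omega⟩⟩
      have hcut : ∀ i j, i ∉ K → j ∉ K → Orth n i j →
          i = 2 * t ∧ j = 2 * t + 1 ∨ i = 2 * t + 1 ∧ j = 2 * t := by
        have hk : ∀ k, 2 * k ∉ K → 2 * k + 1 ∉ K → k = t := fun k h1 h2 => by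
          rcases lt_trichotomy k t with h | h | h
          · exact absurd (hodd k h) h2
          · exact h
          · exact absurd (heven k h) h1
        rintro i j h1 h2 (⟨k, -, ⟨rfl, rfl⟩ | ⟨rfl, rfl⟩⟩ | ⟨rfl, rfl⟩ | ⟨rfl, rfl⟩)
        · obtain rfl := hk k h1 h2
          exact Or.inl ⟨rfl, rfl⟩
        · obtain rfl := hk k h2 h1
          exact Or.inr ⟨rfl, rfl⟩
        · exact absurd (heven n htn) h1
        · exact absurd (heven n htn) h2
      -- Uses 0 < t < n: the points 0 and 2n have a second orthogonal partner. Hence a set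
      -- orthogonal to 2t and containing 2t+1 is {2t+1}, which `hF` excludes.
      have honly : ∀ i, Orth n i (2 * t) → i = 2 * t + 1 := by
        rintro i (⟨k, hk, h⟩ | h) <;> omega
      refine ⟨K, K, ⟨hK, hK, fun a ha b hb h1 h2 => ?_⟩, fun h => h0 (h hi), fun h => h0 (h hj)⟩
      by_contra hab
      have hab' : ∀ i ∈ a.set, ∀ j ∈ b.set, Orth n i j := fun i hi j hj => by
        by_contra h
        exact hab ⟨i, hi, j, hj, h⟩
      obtain ⟨i, hi, hiK⟩ := Set.not_subset.1 h1
      obtain ⟨j, hj, hjK⟩ := Set.not_subset.1 h2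
      rcases hcut i j hiK hjK (hab' i hi j hj) with ⟨rfl, rfl⟩ | ⟨rfl, rfl⟩
      · exact hF b hb (Set.eq_singleton_iff_unique_mem.2
          ⟨hj, fun j' hj' => honly j' (hab' _ hi j' hj').symm⟩)
      · exact hF a ha (Set.eq_singleton_iff_unique_mem.2
          ⟨hi, fun i' hi' => honly i' (hab' i' hi' _ hj)⟩)
    · refine ⟨{i}ᶜ, {j | Orth n j i}, ⟨isClosedSet_of_zero_mem (Ne.symm hi0),
        isClosedSet_orth hn i, fun a _ b _ h1 h2 => ?_⟩, fun h => h hi rfl,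
        fun h => hij (h hj).symm⟩
      obtain ⟨j', hj', hjK⟩ := Set.not_subset.1 h2
      obtain ⟨i', hi', hiK⟩ := Set.not_subset.1 h1
      obtain rfl : i' = i := not_not.1 hiK
      exact ⟨i', hi', j', hj', fun h => hjK h.symm⟩
  · refine ⟨{i | Orth n i j}, {j}ᶜ, ⟨isClosedSet_orth hn j,
      isClosedSet_of_zero_mem (Ne.symm hj0), fun a _ b _ h1 h2 => ?_⟩,
      fun h => hij (h hi), fun h => h hj rfl⟩
    obtain ⟨j', hj', hjK⟩ := Set.not_subset.1 h2
    obtain ⟨i', hi', hiK⟩ := Set.not_subset.1 h1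
    obtain rfl : j' = j := not_not.1 hjK
    exact ⟨i', hi', j', hj', hiK⟩

theorem exists_partial_representation (F : Finset (Elt.{u} n)) (hF : F.card + 1 < n) :
    ∃ (X : Type u) (_ : Nonempty X) (θ : Elt.{u} n → BinRel X),
      ∀ a ∈ F, ∀ b ∈ F, (θ a = θ b → a = b) ∧
        θ (join a b) = BinRel.demonicJoin (θ a) (θ b) ∧
        θ (mul a b) = BinRel.comp (θ a) (θ b) := by
  classical
  -- Pigeonhole: there are n - 1 singletons {2t+1} and fewer members of `F`.
  obtain ⟨t, ht, htF⟩ : ∃ t ∈ Finset.Ico 1 n, ({2 * t + 1} : Set ℕ) ∉ F.image Elt.set := by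
    by_contra! h
    have h1 : (Finset.Ico 1 n).card ≤ (F.image Elt.set).card :=
      Finset.card_le_card_of_injOn (fun t => ({2 * t + 1} : Set ℕ)) h fun s _ t _ hst => by
        have := Set.singleton_injective hst
        omega
    have h2 := h1.trans Finset.card_image_le
    rw [Nat.card_Ico] at h2
    omega
  rw [Finset.mem_Ico] at ht
  refine ⟨Point (F : Set (Elt.{u} n)), ⟨.src⟩, rel (F : Set (Elt.{u} n)), fun a ha b hb =>
    ⟨fun h => rel_injective _ h, rel_join _ a b, ?_⟩⟩
  refine rel_mul (Finset.mem_coe.2 ha) (Finset.mem_coe.2 hb) fun h => ?_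
  exact exists_compatible (by omega) _ ht.1 ht.2
    (fun a ha h => htF (Finset.mem_image.2 ⟨a, ha, h⟩)) h

end Elt

end DemonicJoin

open DemonicJoin in
/-- The class of representable demonic join semigroups is not finitely axiomatisable: no finite
first-order theory has exactly the representable `(+, ∘)`-structures as its models. -/
theorem mainTheorem1 :
    ¬ ∃ Ψ : DemonicJoin.Lang.Theory, Ψ.Finite ∧
      ∀ (S : Type u) [DemonicJoin.Lang.Structure S] [Nonempty S],
        (S ⊨ Ψ ↔ DemonicJoin.Representable S) := by
  rintro ⟨Ψ, hfin, hΨ⟩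
  let U : Ultrafilter ℕ := hyperfilter ℕ
  have hU : ∀ k, ∀ᶠ n in (U : Filter ℕ), k < n := fun k =>
    Nat.hyperfilter_le_atTop (eventually_gt_atTop k)
  have hrep : Representable ((U : Filter ℕ).Product fun n => Elt.{u} n) :=
    representable_product U fun k => (hU (k + 1)).mono fun n hn F hF =>
      Elt.exists_partial_representation F (by omega)
  have hmodel := (hΨ _).2 hrep
  -- Finiteness of `Ψ` lets all its sentences hold simultaneously in almost every factor.
  have hall : ∀ᶠ n in (U : Filter ℕ), ∀ ψ ∈ Ψ, Elt.{u} n ⊨ ψ :=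
    (eventually_all_finite hfin).2 fun ψ hψ =>
      (Ultraproduct.sentence_realize ψ).1 (hmodel.realize_of_mem ψ hψ)
  obtain ⟨n, hn, hn0⟩ := (hall.and (hU 0)).exists
  exact Elt.not_representable hn0 ((hΨ _).1 ⟨hn⟩)
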